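/- Let $\phi(x,y,z)=x^6+y^6+z^6-2x^3y^3-2x^3z^3-2y^3z^3$. Let $m,n$ be independent variables over $\mathbb{Q}$, put $t=m^2-mn+n^2$ and $$A=3(m-n)t^6+(2m-n)(m-2n)t^4-3(m^3+mn^2-n^3)t^2-3m^2t+m-2n,$$ and define elements $x_i,y_i,z_i$ ($i=1,2,3$) of $\mathbb{Q}(m,n)$ by $$\begin{aligned} x_1&=(m-n)((m+n)t+2)(t^3-1)A,\\ y_1&=((m-2n)t-1)((2m-n)t+1)^2(2t^2+m-2n)((m-n)t^3+t^2+m),\\ z_1&=3(m-n)^2t^{11}+9m(m-n)^2t^9+(19m^4-68m^3n+81m^2n^2-35mn^3+4n^4)t^7\\ &\quad+(4m^5-67m^4n+163m^3n^2-176m^2n^3+104mn^4-26n^5)t^5\\ &\quad-(23m^4-22m^3n-18m^2n^2+32mn^3-13n^4)t^4-(19m^3-36m^2n+39mn^2-14n^3)t^3\\ &\quad+(2m^4-7m^3n-6m^2n^2+8mn^3-4n^4)t+(m-2n)(5m^2-5mn+2n^2),\\ x_2&=-(m-n)((m+n)t+2)((m-2n)t-1)((2m-n)t+1)(2t^2+m-2n)(t^3-1),\\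 y_2&=-((2m-n)t+1)((m-n)t^3+t^2+m)A,\\ z_2&=3(m-n)^2t^{11}-(14m^4-37m^3n+36m^2n^2-22mn^3+8n^4)t^7\\ &\quad-(23m^5-98m^4n+140m^3n^2-103m^2n^3+37mn^4-4n^5)t^5\\ &\quad+(m^4+58m^3n-90m^2n^2+46mn^3-5n^4)t^4+(23m^3-12m^2n-9mn^2+8n^3)t^3\\ &\quad+(11m^4-28m^3n+39m^2n^2-19mn^3+2n^4)t-(m-2n)(m^2+2mn-2n^2),\\ x_3&=((m-2n)t-1)((m-n)t^3+t^2+m)A,\\ y_3&=(m-n)((m+n)t+2)((2m-n)t+1)^2(2t^2+m-2n)(t^3-1),\\ z_3&=3(m-n)^2t^{11}+9(m-n)^3t^9+(13m^4-35m^3n+36m^2n^2-14mn^3+n^4)t^7\\ &\quad+(19m^5-55m^4n+79m^3n^2-44m^2n^3-mn^4+7n^5)t^5\\ &\quad+(4m^4-17m^3n+54m^2n^2-41mn^3+10n^4)t^4-2(11m^3-21m^2n+5n^3)t^3\\ &\quad-(22m^4-68m^3n+78m^2n^2-47mn^3+10n^4)t-(m-2n)(4m^2-7mn+4n^2). \end{aligned}$$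 Put $k=\phi(x_1,y_1,z_1)/4\in\mathbb{Q}(m,n)$. Then $\phi(x_1,y_1,z_1)=\phi(x_2,y_2,z_2)=\phi(x_3,y_3,z_3)=4k$, and the Mordell curve $E\colon y^2=x^3+k$ is an elliptic curve over $\mathbb{Q}(m,n)$. For $i=1,2,3$ the three points $$P_i=\Bigl(x_iy_i,\tfrac{x_i^3+y_i^3-z_i^3}{2}\Bigr),\quad Q_i=\Bigl(y_iz_i,\tfrac{y_i^3+z_i^3-x_i^3}{2}\Bigr),\quad R_i=\Bigl(x_iz_i,\tfrac{x_i^3+z_i^3-y_i^3}{2}\Bigr)$$ lie on $E$. One has $P_1=P_2=P_3$, exactly $7$ of these $9$ points are distinct, and the six points $P_1,Q_1,R_1,Q_2,R_2,Q_3$ are linearly independent (over $\mathbb{Z}$) in the group $E(\mathbb{Q}(m,n))$. Consequently the rank of $E(\mathbb{Q}(m,n))$ is at least $6$; that is, the family has generic rank at least $6$. -/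

import Mathlib

namespace MordellChain

/-- The sextic form `φ`. -/
def phi {R : Type*} [CommRing R] (x y z : R) : R :=
  x ^ 6 + y ^ 6 + z ^ 6 - 2 * x ^ 3 * y ^ 3 - 2 * x ^ 3 * z ^ 3 - 2 * y ^ 3 * z ^ 3

section Parametric

variable {R : Type*} [CommRing R]

/-- The auxiliary quantity `t = m² - mn + n²`. -/
def tt (m n : R) : R := m ^ 2 - m * n + n ^ 2

/-- The factor shared by `x₁`, `y₂` and `x₃` in the parametric solution. -/
def commonFactor (m n : R) : R :=
  let t := tt m n;
  3 * (m - n) * t ^ 6 + (2 * m - n) * (m - 2 * n) * t ^ 4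
    - 3 * (m ^ 3 + m * n ^ 2 - n ^ 3) * t ^ 2 - 3 * m ^ 2 * t + m - 2 * n

def x1 (m n : R) : R :=
  let t := tt m n;
  (m - n) * ((m + n) * t + 2) * (t ^ 3 - 1) * commonFactor m n

def y1 (m n : R) : R :=
  let t := tt m n;
  ((m - 2 * n) * t - 1) * ((2 * m - n) * t + 1) ^ 2 * (2 * t ^ 2 + m - 2 * n)
    * ((m - n) * t ^ 3 + t ^ 2 + m)

def z1 (m n : R) : R :=
  let t := tt m n;
  3 * (m - n) ^ 2 * t ^ 11 + 9 * m * (m - n) ^ 2 * t ^ 9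
    + (19 * m ^ 4 - 68 * m ^ 3 * n + 81 * m ^ 2 * n ^ 2 - 35 * m * n ^ 3 + 4 * n ^ 4) * t ^ 7
    + (4 * m ^ 5 - 67 * m ^ 4 * n + 163 * m ^ 3 * n ^ 2 - 176 * m ^ 2 * n ^ 3
        + 104 * m * n ^ 4 - 26 * n ^ 5) * t ^ 5
    - (23 * m ^ 4 - 22 * m ^ 3 * n - 18 * m ^ 2 * n ^ 2 + 32 * m * n ^ 3 - 13 * n ^ 4) * t ^ 4
    - (19 * m ^ 3 - 36 * m ^ 2 * n + 39 * m * n ^ 2 - 14 * n ^ 3) * t ^ 3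
    + t * (2 * m ^ 4 - 7 * m ^ 3 * n - 6 * m ^ 2 * n ^ 2 + 8 * m * n ^ 3 - 4 * n ^ 4)
    + (m - 2 * n) * (5 * m ^ 2 - 5 * m * n + 2 * n ^ 2)

def x2 (m n : R) : R :=
  let t := tt m n;
  -((m - n) * ((m + n) * t + 2) * ((m - 2 * n) * t - 1) * ((2 * m - n) * t + 1)
    * (2 * t ^ 2 + m - 2 * n) * (t ^ 3 - 1))

def y2 (m n : R) : R :=
  let t := tt m n;
  -(((2 * m - n) * t + 1) * ((m - n) * t ^ 3 + t ^ 2 + m) * commonFactor m n)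

def z2 (m n : R) : R :=
  let t := tt m n;
  3 * (m - n) ^ 2 * t ^ 11
    - (14 * m ^ 4 - 37 * m ^ 3 * n + 36 * m ^ 2 * n ^ 2 - 22 * m * n ^ 3 + 8 * n ^ 4) * t ^ 7
    - (23 * m ^ 5 - 98 * m ^ 4 * n + 140 * m ^ 3 * n ^ 2 - 103 * m ^ 2 * n ^ 3
        + 37 * m * n ^ 4 - 4 * n ^ 5) * t ^ 5
    + (m ^ 4 + 58 * m ^ 3 * n - 90 * m ^ 2 * n ^ 2 + 46 * m * n ^ 3 - 5 * n ^ 4) * t ^ 4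
    + (23 * m ^ 3 - 12 * m ^ 2 * n - 9 * m * n ^ 2 + 8 * n ^ 3) * t ^ 3
    + (11 * m ^ 4 - 28 * m ^ 3 * n + 39 * m ^ 2 * n ^ 2 - 19 * m * n ^ 3 + 2 * n ^ 4) * t
    - (m - 2 * n) * (m ^ 2 + 2 * m * n - 2 * n ^ 2)

def x3 (m n : R) : R :=
  let t := tt m n;
  ((m - 2 * n) * t - 1) * ((m - n) * t ^ 3 + t ^ 2 + m) * commonFactor m n

def y3 (m n : R) : R :=
  let t := tt m n;
  (m - n) * ((m + n) * t + 2) * ((2 * m - n) * t + 1) ^ 2 * (2 * t ^ 2 + m - 2 * n)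
    * (t ^ 3 - 1)

def z3 (m n : R) : R :=
  let t := tt m n;
  3 * (m - n) ^ 2 * t ^ 11 + 9 * (m - n) ^ 3 * t ^ 9
    + (13 * m ^ 4 - 35 * m ^ 3 * n + 36 * m ^ 2 * n ^ 2 - 14 * m * n ^ 3 + n ^ 4) * t ^ 7
    + (19 * m ^ 5 - 55 * m ^ 4 * n + 79 * m ^ 3 * n ^ 2 - 44 * m ^ 2 * n ^ 3
        - m * n ^ 4 + 7 * n ^ 5) * t ^ 5
    + (4 * m ^ 4 - 17 * m ^ 3 * n + 54 * m ^ 2 * n ^ 2 - 41 * m * n ^ 3 + 10 * n ^ 4) * t ^ 4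
    - 2 * (11 * m ^ 3 - 21 * m ^ 2 * n + 5 * n ^ 3) * t ^ 3
    - t * (22 * m ^ 4 - 68 * m ^ 3 * n + 78 * m ^ 2 * n ^ 2 - 47 * m * n ^ 3 + 10 * n ^ 4)
    - (m - 2 * n) * (4 * m ^ 2 - 7 * m * n + 4 * n ^ 2)

/-- The `x`-entries of the three triples of the chain. -/
def xs (m n : R) : Fin 3 → R := ![x1 m n, x2 m n, x3 m n]

/-- The `y`-entries of the three triples of the chain. -/
def ys (m n : R) : Fin 3 → R := ![y1 m n, y2 m n, y3 m n]

/-- The `z`-entries of the three triples of the chain. -/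
def zs (m n : R) : Fin 3 → R := ![z1 m n, z2 m n, z3 m n]

end Parametric

/-- The Mordell curve `y² = x³ + k`. -/
def mordell {F : Type*} [Field F] (k : F) : WeierstrassCurve.Affine F :=
  { a₁ := 0, a₂ := 0, a₃ := 0, a₄ := 0, a₆ := k }

/-- The abscissas of the three points attached to a triple `(x, y, z)`. -/
def abscissa {F : Type*} [Field F] (x y z : F) : Fin 3 → F :=
  ![x * y, y * z, x * z]

/-- The ordinates of the three points attached to a triple `(x, y, z)`. -/
def ordinate {F : Type*} [Field F] (x y z : F) : Fin 3 → F :=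
  ![(x ^ 3 + y ^ 3 - z ^ 3) / 2, (y ^ 3 + z ^ 3 - x ^ 3) / 2, (x ^ 3 + z ^ 3 - y ^ 3) / 2]

/-- The field `ℚ(m, n)` of rational functions in two independent variables. -/
abbrev QMN : Type := FractionRing (MvPolynomial (Fin 2) ℚ)

/-- Decidable equality, as needed by the group law on points. -/
noncomputable instance instDecidableEqQMN : DecidableEq QMN := Classical.decEq _

/-- The variable `m`, as an element of `ℚ(m, n)`. -/
noncomputable def mvar : QMN := algebraMap (MvPolynomial (Fin 2) ℚ) QMN (MvPolynomial.X 0)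

/-- The variable `n`, as an element of `ℚ(m, n)`. -/
noncomputable def nvar : QMN := algebraMap (MvPolynomial (Fin 2) ℚ) QMN (MvPolynomial.X 1)

/-- `k = φ(x₁, y₁, z₁) / 4 ∈ ℚ(m, n)`. -/
noncomputable def kgen : QMN := phi (x1 mvar nvar) (y1 mvar nvar) (z1 mvar nvar) / 4

/-- The generic member of the family: `y² = x³ + k` over `ℚ(m, n)`. -/
noncomputable def genericCurve : WeierstrassCurve.Affine QMN := mordell kgen

end MordellChain

/-! By `phi_eq_sq_sub`, the three values of `phi` agree, and the points with abscissas x_i y_i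
coincide, once x_i y_i and x_i³ + y_i³ - z_i³ are independent of i. The products are one set of
factors grouped in three ways. Each resulting identity between differences of cubes splits into a
linear factor and a norm from ℤ[ω], ω a primitive cube root of unity, and norms are multiplicative.

Independence is a 2-descent. If θ³ = -k in an extension L of ℚ(m, n), then P ↦ x(P) - θ is a
homomorphism from the points to Lˣ modulo squares (`isSquare_xSub_mul_xSub_mul_xSub_add`), so it
kills doubles. Here L = ℚ_19: sending m and n to algebraically independent 19-adic integers with
prescribed residues embeds the whole field ℚ(m, n), and Hensel's lemma supplies θ. Membership in the
relevant subgroup of Lˣ is then read off modulo 19.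

Six choices of residues give six subgroups of points, each containing all doubles and all but one of
the six points (`isSquare_residue_iff`, a finite computation). So every integral relation has even
coefficients. There is no 2-torsion, since -k is not a cube (`cube_ne_neg_kgen`, also seen modulo
19), so relations can be halved forever and must be trivial. -/

namespace MordellChain

/-! ### Factorizations and norm identities behind the chain. -/

section Identities

variable {R : Type*} [CommRing R]

/-- The factor `(m - n)((m + n)t + 2)(t³ - 1)` of `x₁`. -/
def factorU (m n : R) : R := (m - n) * ((m + n) * tt m n + 2) * (tt m n ^ 3 - 1)

/-- The factor `(m - 2n)t - 1` of `y₁`. -/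
def factorD (m n : R) : R := (m - 2 * n) * tt m n - 1

/-- The factor `(2m - n)t + 1` of `y₁`. -/
def factorE (m n : R) : R := (2 * m - n) * tt m n + 1

/-- The factor `2t² + m - 2n` of `y₁`. -/
def factorF (m n : R) : R := 2 * tt m n ^ 2 + m - 2 * n

/-- The factor `(m - n)t³ + t² + m` of `y₁`. -/
def factorG (m n : R) : R := (m - n) * tt m n ^ 3 + tt m n ^ 2 + m

theorem x1_eq (m n : R) : x1 m n = factorU m n * commonFactor m n := by
  simp only [x1, factorU]

theorem y1_eq (m n : R) :
    y1 m n = factorD m n * factorE m n ^ 2 * factorF m n * factorG m n := by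
  simp only [y1, factorD, factorE, factorF, factorG]

theorem x2_eq (m n : R) :
    x2 m n = -(factorU m n * (factorD m n * factorE m n * factorF m n)) := by
  simp only [x2, factorU, factorD, factorE, factorF]; ring

theorem y2_eq (m n : R) : y2 m n = -(factorE m n * factorG m n * commonFactor m n) := by
  simp only [y2, factorE, factorG]

theorem x3_eq (m n : R) : x3 m n = factorD m n * factorG m n * commonFactor m n := by
  simp only [x3, factorD, factorG]

theorem y3_eq (m n : R) : y3 m n = factorU m n * (factorE m n ^ 2 * factorF m n) := by
  simp only [y3, factorU, factorE, factorF]; ring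

theorem x2_mul_y2 (m n : R) : x2 m n * y2 m n = x1 m n * y1 m n := by
  rw [x1_eq, y1_eq, x2_eq, y2_eq]; ring

theorem x3_mul_y3 (m n : R) : x3 m n * y3 m n = x1 m n * y1 m n := by
  rw [x1_eq, y1_eq, x3_eq, y3_eq]; ring

theorem tt_mul_z1_sub_z2 (m n : R) : tt m n * (z1 m n - z2 m n) =
    (factorU m n + factorE m n * factorG m n) *
      (commonFactor m n + factorD m n * factorE m n * factorF m n) := by
  simp only [z1, z2, commonFactor, factorU, factorD, factorE, factorF, factorG, tt]
  ring

theorem z1_eq (m n : R) : z1 m n =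
    (n - m) * (factorU m n * commonFactor m n - (factorE m n * factorG m n) *
      (factorD m n * factorE m n * factorF m n)) +
    m * (factorU m n * (factorD m n * factorE m n * factorF m n) +
      (factorE m n * factorG m n) * commonFactor m n -
      (factorE m n * factorG m n) * (factorD m n * factorE m n * factorF m n)) := by
  simp only [z1, commonFactor, factorU, factorD, factorE, factorF, factorG, tt]
  ring

theorem z2_eq (m n : R) : z2 m n =
    m * (factorU m n * commonFactor m n - (factorE m n * factorG m n) *
      (factorD m n * factorE m n * factorF m n)) -
    n * (factorU m n * (factorD m n * factorE m n * factorF m n) +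
      (factorE m n * factorG m n) * commonFactor m n -
      (factorE m n * factorG m n) * (factorD m n * factorE m n * factorF m n)) := by
  simp only [z2, commonFactor, factorU, factorD, factorE, factorF, factorG, tt]
  ring

theorem tt_mul_z1_sub_z3 (m n : R) : tt m n * (z1 m n - z3 m n) =
    (factorU m n - factorD m n * factorG m n) *
      (commonFactor m n - factorE m n ^ 2 * factorF m n) := by
  simp only [z1, z3, commonFactor, factorU, factorD, factorE, factorF, factorG, tt]
  ring

theorem z1_z3_bilinear_left (m n : R) :
    (m * tt m n - n * tt m n + 1) * z1 m n - (n * tt m n - 1) * z3 m n =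
    -m * ((factorU m n + factorD m n * factorG m n) *
        (commonFactor m n + factorE m n ^ 2 * factorF m n)
      - (factorD m n * factorG m n) * (factorE m n ^ 2 * factorF m n)) +
    (tt m n ^ 2 + m - n) * ((factorU m n + factorD m n * factorG m n) *
        (factorE m n ^ 2 * factorF m n) +
      (factorD m n * factorG m n) * commonFactor m n) := by
  simp only [z1, z3, commonFactor, factorU, factorD, factorE, factorF, factorG, tt]
  ring

theorem z1_z3_bilinear_right (m n : R) :
    (n * tt m n - 1) * z1 m n + m * tt m n * z3 m n =
    (tt m n ^ 2 + m - n) * ((factorU m n + factorD m n * factorG m n) *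
        (commonFactor m n + factorE m n ^ 2 * factorF m n)
      - (factorD m n * factorG m n) * (factorE m n ^ 2 * factorF m n)) -
    (tt m n ^ 2 - n) * ((factorU m n + factorD m n * factorG m n) *
        (factorE m n ^ 2 * factorF m n) +
      (factorD m n * factorG m n) * commonFactor m n) := by
  simp only [z1, z3, commonFactor, factorU, factorD, factorE, factorF, factorG, tt]
  ring

/-- The quantities ua - vd and ud + va - vd are the coordinates of (u + vω)(a + dω), and t is the
norm of m + nω. So z² + zw + w² is t times a product of two norms, and `h` absorbs that t without
any division. -/
theorem cube_sub_cube_of_bilinear {m n t z w u v a d : R} (ht : t = m ^ 2 - m * n + n ^ 2)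
    (h : t * (z - w) = (u + v) * (a + d))
    (hz : z = (n - m) * (u * a - v * d) + m * (u * d + v * a - v * d))
    (hw : w = m * (u * a - v * d) - n * (u * d + v * a - v * d)) :
    z ^ 3 - w ^ 3 = (u ^ 3 + v ^ 3) * (a ^ 3 + d ^ 3) := by
  have key : z ^ 2 + z * w + w ^ 2 =
      t * ((u ^ 2 - u * v + v ^ 2) * (a ^ 2 - a * d + d ^ 2)) := by
    rw [hz, hw, ht]; ring
  linear_combination (z - w) * key + (u ^ 2 - u * v + v ^ 2) * (a ^ 2 - a * d + d ^ 2) * h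

theorem z1_cube_sub_z2_cube (m n : R) : z1 m n ^ 3 - z2 m n ^ 3 =
    x1 m n ^ 3 + y1 m n ^ 3 - x2 m n ^ 3 - y2 m n ^ 3 := by
  rw [cube_sub_cube_of_bilinear rfl (tt_mul_z1_sub_z2 m n) (z1_eq m n) (z2_eq m n),
    x1_eq, y1_eq, x2_eq, y2_eq]
  ring

/-- The same norm argument, except that z and w are known only after multiplication by an element of
norm t³ + mt - 2nt + 1: with ζ² = ζ - 1, the left sides of `hl` and `hr` are the coordinates of ((mt
- nt + 1) + (nt - 1)ζ)(z + wζ). That norm remains as a factor to be cancelled. -/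
theorem cube_sub_cube_of_bilinear_mul {m n t z w u v a d : R}
    (ht : t = m ^ 2 - m * n + n ^ 2)
    (h : t * (z - w) = (u - v) * (a - d))
    (hl : (m * t - n * t + 1) * z - (n * t - 1) * w =
      -m * ((u + v) * (a + d) - v * d) + (t ^ 2 + m - n) * ((u + v) * d + v * a))
    (hr : (n * t - 1) * z + m * t * w =
      (t ^ 2 + m - n) * ((u + v) * (a + d) - v * d) - (t ^ 2 - n) * ((u + v) * d + v * a)) :
    (t ^ 3 + m * t - 2 * n * t + 1) * (z ^ 3 - w ^ 3) =
      (t ^ 3 + m * t - 2 * n * t + 1) * ((u ^ 3 - v ^ 3) * (a ^ 3 - d ^ 3)) := by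
  have e1 : ((m * t - n * t + 1) * z - (n * t - 1) * w) ^ 2 +
      ((m * t - n * t + 1) * z - (n * t - 1) * w) * ((n * t - 1) * z + m * t * w) +
      ((n * t - 1) * z + m * t * w) ^ 2 =
      (t ^ 3 + m * t - 2 * n * t + 1) * (z ^ 2 + z * w + w ^ 2) := by
    rw [ht]; ring
  rw [hl, hr] at e1
  have key : (t ^ 3 + m * t - 2 * n * t + 1) * (z ^ 2 + z * w + w ^ 2) =
      (t ^ 3 + m * t - 2 * n * t + 1) *
        (t * ((u ^ 2 + u * v + v ^ 2) * (a ^ 2 + a * d + d ^ 2))) := by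
    rw [← e1, ht]; ring
  linear_combination (z - w) * key +
    (t ^ 3 + m * t - 2 * n * t + 1) * (u ^ 2 + u * v + v ^ 2) * (a ^ 2 + a * d + d ^ 2) * h

theorem z1_cube_sub_z3_cube [IsDomain R] {m n : R}
    (h : tt m n ^ 3 + m * tt m n - 2 * n * tt m n + 1 ≠ 0) : z1 m n ^ 3 - z3 m n ^ 3 =
    x1 m n ^ 3 + y1 m n ^ 3 - x3 m n ^ 3 - y3 m n ^ 3 := by
  rw [mul_left_cancel₀ h (cube_sub_cube_of_bilinear_mul rfl (tt_mul_z1_sub_z3 m n)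
    (z1_z3_bilinear_left m n) (z1_z3_bilinear_right m n)), x1_eq, y1_eq, x3_eq, y3_eq]
  ring

theorem phi_eq_sq_sub (x y z : R) :
    phi x y z = (x ^ 3 + y ^ 3 - z ^ 3) ^ 2 - 4 * (x * y) ^ 3 := by
  simp only [phi]; ring

end Identities

/-! ### 2-descent on y² = x³ + k through a cube root of -k. -/

section Descent

/-- Without 2-torsion, halving the coefficients of a relation gives another relation, so every
coefficient is divisible by all powers of 2. -/
theorem linearIndependent_int_of_even {ι G : Type*} [Fintype ι] [AddCommGroup G] {v : ι → G}
    (htors : ∀ g : G, (2 : ℤ) • g = 0 → g = 0)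
    (heven : ∀ c : ι → ℤ, ∑ i, c i • v i = 0 → ∀ i, Even (c i)) : LinearIndependent ℤ v := by
  have hdvd (k : ℕ) : ∀ c : ι → ℤ, ∑ i, c i • v i = 0 → ∀ i, (2 : ℤ) ^ k ∣ c i := by
    induction k with
    | zero => simp
    | succ k ih =>
      intro c hc i
      choose d hd using fun j ↦ (even_iff_two_dvd.mp (heven c hc j))
      have hd' : ∑ j, d j • v j = 0 := by
        apply htors
        rw [Finset.smul_sum, ← hc]
        exact Finset.sum_congr rfl fun j _ ↦ by rw [hd j, mul_smul]
      rw [hd i, pow_succ']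
      exact mul_dvd_mul_left 2 (ih d hd' i)
  refine Fintype.linearIndependent_iff.mpr fun c hc i ↦ ?_
  by_contra hi
  obtain ⟨k, hk⟩ := exists_nat_gt (c i).natAbs
  have := Nat.le_of_dvd (Int.natAbs_pos.mpr hi) (Int.natAbs_dvd_natAbs.mpr (hdvd k c hc i))
  rw [Int.natAbs_pow] at this
  have h2 : k < 2 ^ k := Nat.lt_two_pow_self
  simp at hk this
  omega

variable {K L : Type*} [Field K] [Field L] {k : K} (f : K →+* L) (θ : L)

/-- The function `x - θ` on the points of `y² = x³ + k`, with value `1` at infinity. -/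
def xSub : (mordell k).Point → L
  | .zero => 1
  | .some x _ _ => f x - θ

theorem xSub_ne_zero (hθ : θ ^ 3 = -f k) (hk : ∀ x : K, x ^ 3 ≠ -k) (P : (mordell k).Point) :
    xSub f θ P ≠ 0 := by
  rcases P with _ | ⟨x, y, h⟩
  · exact one_ne_zero
  · intro h0
    refine hk x (f.injective ?_)
    rw [map_pow, map_neg, ← hθ, sub_eq_zero.mp h0]

variable [DecidableEq K]

/-- If Y = ℓ(X) is the line through P and Q, then X³ + k - ℓ(X)² is the product of the X - x_i over
its three intersections with the curve. At X = θ the cubic X³ + k vanishes, and the product of the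
x_i - θ is ℓ(θ)². -/
theorem isSquare_xSub_mul_xSub_mul_xSub_add (hθ : θ ^ 3 = -f k) (P Q : (mordell k).Point) :
    IsSquare (xSub f θ P * xSub f θ Q * xSub f θ (P + Q)) := by
  rcases P with _ | ⟨x₁, y₁, h₁⟩
  · change IsSquare (1 * xSub f θ Q * xSub f θ (0 + Q))
    rw [zero_add, one_mul]
    exact IsSquare.mul_self _
  rcases Q with _ | ⟨x₂, y₂, h₂⟩
  · change IsSquare (xSub f θ (.some x₁ y₁ h₁) * 1 * xSub f θ (.some x₁ y₁ h₁ + 0))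
    rw [add_zero, mul_one]
    exact IsSquare.mul_self _
  by_cases hxy : x₁ = x₂ ∧ y₁ = (mordell k).negY x₂ y₂
  · rw [WeierstrassCurve.Affine.Point.add_of_Y_eq hxy.1 hxy.2]
    change IsSquare ((f x₁ - θ) * (f x₂ - θ) * 1)
    rw [hxy.1, mul_one]
    exact IsSquare.mul_self _
  · rw [WeierstrassCurve.Affine.Point.add_some hxy]
    have key := congrArg (Polynomial.eval₂ f θ)
      (WeierstrassCurve.Affine.addPolynomial_slope h₁.left h₂.left hxy)
    rw [WeierstrassCurve.Affine.addPolynomial_eq] at key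
    have h2 : Polynomial.eval₂ f θ 2 = 2 := by
      rw [← Polynomial.C_ofNat, Polynomial.eval₂_C, map_ofNat]
    simp only [mordell, Cubic.toPoly, Polynomial.eval₂_add, Polynomial.eval₂_mul,
      Polynomial.eval₂_neg, Polynomial.eval₂_sub, Polynomial.eval₂_pow, Polynomial.eval₂_X,
      Polynomial.eval₂_C, map_neg, map_one, map_mul, map_add, map_sub, map_pow, map_zero,
      map_ofNat, h2, Polynomial.eval₂_one, Polynomial.eval₂_zero] at key
    refine ⟨f ((mordell k).slope x₁ x₂ y₁ y₂) * (θ - f x₁) + f y₁, ?_⟩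
    simp only [xSub, mordell]
    linear_combination -key - hθ

theorem xSub_add_mem (hθ : θ ^ 3 = -f k) (hk : ∀ x : K, x ^ 3 ≠ -k) {T : Subgroup Lˣ}
    (hT : ∀ a : Lˣ, a ^ 2 ∈ T) (P Q : (mordell k).Point) :
    Units.mk0 _ (xSub_ne_zero f θ hθ hk P) * Units.mk0 _ (xSub_ne_zero f θ hθ hk Q) *
      Units.mk0 _ (xSub_ne_zero f θ hθ hk (P + Q)) ∈ T := by
  obtain ⟨s, hs⟩ := isSquare_xSub_mul_xSub_mul_xSub_add f θ hθ P Q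
  have hne (P : (mordell k).Point) := xSub_ne_zero f θ hθ hk P
  have hs0 : s ≠ 0 := by
    rintro rfl
    exact mul_ne_zero (mul_ne_zero (hne P) (hne Q)) (hne (P + Q)) (by simpa using hs)
  convert! hT (Units.mk0 s hs0)
  ext
  simpa [sq] using hs

/-- The points of `y² = x³ + k` at which `x - θ` lies in a given subgroup of `Lˣ` containing the
squares. -/
def descentSubgroup (hθ : θ ^ 3 = -f k) (hk : ∀ x : K, x ^ 3 ≠ -k) (T : Subgroup Lˣ)
    (hT : ∀ a : Lˣ, a ^ 2 ∈ T) : AddSubgroup (mordell k).Point where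
  carrier := {P | Units.mk0 _ (xSub_ne_zero f θ hθ hk P) ∈ T}
  zero_mem' := by
    change Units.mk0 (1 : L) _ ∈ T
    rw [Units.mk0_one]
    exact T.one_mem
  add_mem' {P Q} hP hQ :=
    (T.mul_mem_cancel_left (T.mul_mem hP hQ)).mp (xSub_add_mem f θ hθ hk hT P Q)
  neg_mem' {P} hP := by
    rcases P with _ | ⟨x, y, h⟩ <;> exact hP

theorem two_zsmul_mem_descentSubgroup (hθ : θ ^ 3 = -f k) (hk : ∀ x : K, x ^ 3 ≠ -k)
    {T : Subgroup Lˣ} (hT : ∀ a : Lˣ, a ^ 2 ∈ T) (P : (mordell k).Point) :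
    (2 : ℤ) • P ∈ descentSubgroup f θ hθ hk T hT := by
  rw [two_zsmul]
  refine (T.mul_mem_cancel_left ?_).mp (xSub_add_mem f θ hθ hk hT P P)
  rw [← sq]
  exact hT _

/-- In the quotient by `S`, which is killed by 2, the relation reduces to `c i` times a nonzero
class. -/
theorem even_of_sum_zsmul_eq_zero {ι G : Type*} [Fintype ι] [AddCommGroup G] {v : ι → G}
    {S : AddSubgroup G} (hS : ∀ g : G, (2 : ℤ) • g ∈ S) {i : ι} (hi : v i ∉ S)
    (hv : ∀ j ≠ i, v j ∈ S) {c : ι → ℤ} (hc : ∑ j, c j • v j = 0) : Even (c i) := by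
  classical
  by_contra hodd
  obtain ⟨d, hd⟩ := Int.not_even_iff_odd.mp hodd
  rw [← Finset.add_sum_erase _ _ (Finset.mem_univ i), hd, add_smul, one_smul, mul_smul] at hc
  refine hi ?_
  have h : v i = -((2 : ℤ) • d • v i + ∑ j ∈ Finset.univ.erase i, c j • v j) := by
    rw [eq_neg_iff_add_eq_zero, ← hc]
    abel
  rw [h]
  exact S.neg_mem (S.add_mem (hS _) (S.sum_mem fun j hj ↦
    S.zsmul_mem (hv j (Finset.ne_of_mem_erase hj)) _))

/-- A point of order 2 has ordinate 0, so its abscissa would be a cube root of -k. -/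
theorem eq_zero_of_two_zsmul_eq_zero (h2 : (2 : K) ≠ 0) (hk : ∀ x : K, x ^ 3 ≠ -k)
    (P : (mordell k).Point) (h : (2 : ℤ) • P = 0) : P = 0 := by
  rcases P with _ | ⟨x, y, hP⟩
  · rfl
  · rw [two_zsmul, add_eq_zero_iff_eq_neg, WeierstrassCurve.Affine.Point.neg_some,
      WeierstrassCurve.Affine.Point.some.injEq] at h
    have hy : y = 0 := by
      have := h.2
      simp only [WeierstrassCurve.Affine.negY, mordell] at this
      have h3 : 2 * y = 0 := by linear_combination this
      exact (mul_eq_zero.mp h3).resolve_left h2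
    have := (WeierstrassCurve.Affine.equation_iff _ _).mp hP.left
    simp only [mordell, hy] at this
    exact absurd (by linear_combination -this) (hk x)

end Descent

/-! ### Embeddings of ℚ(m, n) into ℚ_p with prescribed residues. -/

section Padic

theorem toZMod_eq_zero_iff {p : ℕ} [Fact p.Prime] {x : ℤ_[p]} :
    PadicInt.toZMod x = 0 ↔ ‖x‖ < 1 := by
  rw [← RingHom.mem_ker, PadicInt.ker_toZMod, ← PadicInt.mem_nonunits,
    IsLocalRing.mem_maximalIdeal]

-- Hensel's lemma at a simple root modulo p. With c = 4k, the equation θ³ = -k is used in a form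
-- free of denominators.
open Polynomial in
theorem exists_root_of_toZMod {p : ℕ} [Fact p.Prime] (c : ℤ_[p]) (θ₀ : ZMod p)
    (h : 4 * θ₀ ^ 3 + PadicInt.toZMod c = 0) (h' : 12 * θ₀ ^ 2 ≠ 0) :
    ∃ θ : ℤ_[p], 4 * θ ^ 3 + c = 0 ∧ PadicInt.toZMod θ = θ₀ := by
  obtain ⟨a, rfl⟩ := ZMod.ringHom_surjective (PadicInt.toZMod (p := p)) θ₀
  have e1 (z : ℤ_[p]) : aeval z (4 * X ^ 3 + C c : ℤ_[p][X]) = 4 * z ^ 3 + c := by simp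
  have e2 (z : ℤ_[p]) : aeval z (derivative (4 * X ^ 3 + C c : ℤ_[p][X])) = 12 * z ^ 2 := by
    simp; ring
  have hd : ‖aeval a (derivative (4 * X ^ 3 + C c : ℤ_[p][X]))‖ = 1 := by
    rw [e2]
    refine le_antisymm (PadicInt.norm_le_one _) (not_lt.mp fun hl ↦ h' ?_)
    have h4 := toZMod_eq_zero_iff.mpr hl
    rwa [map_mul, map_pow, map_ofNat] at h4
  obtain ⟨θ, h0, h1, -⟩ := hensels_lemma (F := (4 * X ^ 3 + C c : ℤ_[p][X])) (a := a) (by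
    rw [hd, e1, one_pow, ← toZMod_eq_zero_iff, map_add, map_mul, map_pow, map_ofNat]; exact h)
  refine ⟨θ, by rw [← e1, h0], ?_⟩
  rw [hd, ← toZMod_eq_zero_iff, map_sub, sub_eq_zero] at h1
  exact h1

-- A residue class is an open ball, hence has at least continuum many elements, while only countably
-- many p-adic numbers are algebraic over a countable ring.
open Cardinal in
theorem exists_transcendental_toZMod {p : ℕ} [Fact p.Prime] (R : Type*) [CommRing R] [IsDomain R]
    [Countable R] [Algebra R ℚ_[p]] [Module.IsTorsionFree R ℚ_[p]] (a : ZMod p) :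
    ∃ u : ℤ_[p], PadicInt.toZMod u = a ∧ Transcendental R (u : ℚ_[p]) := by
  obtain ⟨a, rfl⟩ := ZMod.ringHom_surjective (PadicInt.toZMod (p := p)) a
  have h1 : 𝔠 ≤ #(Metric.ball (a : ℚ_[p]) 1) :=
    continuum_le_cardinal_of_isOpen ℚ_[p] Metric.isOpen_ball ⟨_, Metric.mem_ball_self one_pos⟩
  have h2 : ¬ Metric.ball (a : ℚ_[p]) 1 ⊆ {x : ℚ_[p] | IsAlgebraic R x} := fun h ↦
    absurd (h1.trans ((Algebraic.countable R ℚ_[p]).mono h).le_aleph0)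
      (not_le.mpr aleph0_lt_continuum)
  obtain ⟨u, hu, hu'⟩ := Set.not_subset.mp h2
  rw [Metric.mem_ball, dist_eq_norm] at hu
  have hle : ‖u‖ ≤ 1 := by
    have := Padic.nonarchimedean (u - (a : ℚ_[p])) (a : ℚ_[p])
    rw [sub_add_cancel] at this
    exact this.trans (max_le hu.le a.2)
  obtain ⟨u, rfl⟩ : ∃ w : ℤ_[p], (w : ℚ_[p]) = u := ⟨⟨u, hle⟩, rfl⟩
  refine ⟨u, ?_, hu'⟩
  rw [← sub_eq_zero, ← map_sub, ← RingHom.mem_ker, PadicInt.ker_toZMod,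
    IsLocalRing.mem_maximalIdeal, PadicInt.mem_nonunits]
  exact hu

theorem exists_algebraicIndependent_toZMod {p : ℕ} [Fact p.Prime] (a b : ZMod p) :
    ∃ u v : ℤ_[p], PadicInt.toZMod u = a ∧ PadicInt.toZMod v = b ∧
      AlgebraicIndependent ℚ ![(u : ℚ_[p]), v] := by
  obtain ⟨v, hv, hv'⟩ := exists_transcendental_toZMod ℚ b
  have hx : AlgebraicIndependent ℚ ![(v : ℚ_[p])] := by
    rwa [algebraicIndependent_iff_transcendental]
  -- ℚ[v] is again countable, so u can be chosen transcendental over it.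
  have : Countable (Algebra.adjoin ℚ (Set.range ![(v : ℚ_[p])])) := by
    have : Countable (MvPolynomial (Fin 1) ℚ) := by
      rw [← Cardinal.mk_le_aleph0_iff]
      exact MvPolynomial.cardinalMk_le_max.trans (by simp)
    have := hx.aevalEquiv.symm.injective.countable
    exact this
  obtain ⟨u, hu, hu'⟩ := exists_transcendental_toZMod
    (Algebra.adjoin ℚ (Set.range ![(v : ℚ_[p])])) a
  refine ⟨u, v, hu, hv, ?_⟩
  have := (hx.option_iff_transcendental (u : ℚ_[p])).mpr hu'
  rw [← algebraicIndependent_equiv (finSuccEquiv 1)] at this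
  convert! this using 1
  ext i
  fin_cases i <;> rfl

/-- Algebraic independence makes evaluation injective on polynomials, so it extends to all of ℚ(m,
n) and no denominator can vanish. -/
theorem exists_ringHom_padic {p : ℕ} [Fact p.Prime] (a b : ZMod p) :
    ∃ (f : QMN →+* ℚ_[p]) (u v : ℤ_[p]), f mvar = u ∧ f nvar = v ∧
      PadicInt.toZMod u = a ∧ PadicInt.toZMod v = b := by
  obtain ⟨u, v, hu, hv, h⟩ := exists_algebraicIndependent_toZMod a b
  let g := (MvPolynomial.aeval ![(u : ℚ_[p]), v] : MvPolynomial (Fin 2) ℚ →ₐ[ℚ] ℚ_[p]).toRingHom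
  have hg : Function.Injective g := h
  have hX (i : Fin 2) : IsFractionRing.lift (K := QMN) hg
      (algebraMap (MvPolynomial (Fin 2) ℚ) QMN (MvPolynomial.X i)) = ![(u : ℚ_[p]), v] i :=
    (IsFractionRing.lift_algebraMap hg _).trans (MvPolynomial.aeval_X _ i)
  exact ⟨IsFractionRing.lift hg, u, v, hX 0, hX 1, hu, hv⟩

end Padic

/-! ### Reduction of the parametric formulas, and square classes in ℚ_p. -/

section Specialization

variable {R S : Type*} [CommRing R] [CommRing S]

/-- The products `x_i y_i`, `y_i z_i`, `x_i z_i` over a commutative ring. -/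
def products (m n : R) (i : Fin 3) : Fin 3 → R :=
  ![xs m n i * ys m n i, ys m n i * zs m n i, xs m n i * zs m n i]

theorem map_xs (f : R →+* S) (m n : R) (i : Fin 3) : f (xs m n i) = xs (f m) (f n) i := by
  fin_cases i <;> simp [xs, x1, x2, x3, commonFactor, tt, map_ofNat]

theorem map_ys (f : R →+* S) (m n : R) (i : Fin 3) : f (ys m n i) = ys (f m) (f n) i := by
  fin_cases i <;> simp [ys, y1, y2, y3, commonFactor, tt, map_ofNat]

theorem map_zs (f : R →+* S) (m n : R) (i : Fin 3) : f (zs m n i) = zs (f m) (f n) i := by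
  fin_cases i <;> simp [zs, z1, z2, z3, tt, map_ofNat]

theorem map_products (f : R →+* S) (m n : R) (i j : Fin 3) :
    f (products m n i j) = products (f m) (f n) i j := by
  fin_cases j <;> simp [products, map_xs, map_ys, map_zs]

/-- The value `φ(x₁, y₁, z₁) = 4k` over a commutative ring. -/
def fourK (m n : R) : R := phi (xs m n 0) (ys m n 0) (zs m n 0)

theorem map_fourK (f : R →+* S) (m n : R) : f (fourK m n) = fourK (f m) (f n) := by
  simp [fourK, phi, map_ofNat, map_xs, map_ys, map_zs]

theorem four_mul_kgen : 4 * kgen = fourK mvar nvar :=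
  mul_div_cancel₀ _ (by norm_num)

theorem exists_padic_specialization {p : ℕ} [Fact p.Prime] (a b : ZMod p) :
    ∃ (f : QMN →+* ℚ_[p]) (c : ℤ_[p]) (w : Fin 3 → Fin 3 → ℤ_[p]),
      4 * f kgen = c ∧ PadicInt.toZMod c = fourK a b ∧
      ∀ i j, f (products mvar nvar i j) = w i j ∧ PadicInt.toZMod (w i j) = products a b i j := by
  obtain ⟨f, u, v, hu, hv, rfl, rfl⟩ := exists_ringHom_padic a b
  refine ⟨f, fourK u v, products u v, ?_, map_fourK _ _ _, fun i j ↦ ⟨?_, map_products _ _ _ _ _⟩⟩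
  · rw [← map_ofNat f 4, ← map_mul, four_mul_kgen, map_fourK, hu, hv]
    exact (map_fourK PadicInt.Coe.ringHom u v).symm
  · rw [map_products, hu, hv]
    exact (map_products PadicInt.Coe.ringHom u v i j).symm

/-- The subgroup of `ℚ_pˣ` generated by the squares and the units of `ℤ_p` whose residue is a
square. -/
def residueSquares (p : ℕ) [Fact p.Prime] : Subgroup ℚ_[p]ˣ where
  carrier := {a | ∃ (s : ℚ_[p]) (w : ℤ_[p]), (a : ℚ_[p]) = s ^ 2 * w ∧
    IsSquare (PadicInt.toZMod w) ∧ PadicInt.toZMod w ≠ 0}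
  one_mem' := ⟨1, 1, by simp, by simp, by simp⟩
  mul_mem' := by
    rintro a b ⟨s, w, h, hw, h0⟩ ⟨s', w', h', hw', h0'⟩
    refine ⟨s * s', w * w', ?_, ?_, ?_⟩
    · rw [Units.val_mul, h, h', PadicInt.coe_mul]; ring
    · rw [map_mul]; exact hw.mul hw'
    · rw [map_mul]; exact mul_ne_zero h0 h0'
  inv_mem' := by
    rintro a ⟨s, w, h, hw, h0⟩
    refine ⟨s * (a : ℚ_[p])⁻¹, w, ?_, hw, h0⟩
    rw [Units.val_inv_eq_inv_val, mul_pow, mul_right_comm, ← h, sq, mul_inv_cancel_left₀ a.ne_zero]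

theorem sq_mem_residueSquares {p : ℕ} [Fact p.Prime] (a : ℚ_[p]ˣ) : a ^ 2 ∈ residueSquares p :=
  ⟨a, 1, by simp, by simp, by simp⟩

theorem norm_eq_one_of_toZMod_ne_zero {p : ℕ} [Fact p.Prime] {x : ℤ_[p]}
    (h : PadicInt.toZMod x ≠ 0) : ‖(x : ℚ_[p])‖ = 1 := by
  rw [← PadicInt.norm_def]
  exact le_antisymm (PadicInt.norm_le_one _) (not_lt.mp (mt toZMod_eq_zero_iff.mpr h))

/-- Comparing norms in a = s²w' forces s to be a unit, so the residues of w and w' differ by a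
nonzero square. -/
theorem mem_residueSquares_iff {p : ℕ} [Fact p.Prime] {a : ℚ_[p]ˣ} {w : ℤ_[p]}
    (h : (a : ℚ_[p]) = w) (h0 : PadicInt.toZMod w ≠ 0) :
    a ∈ residueSquares p ↔ IsSquare (PadicInt.toZMod w) := by
  refine ⟨?_, fun hw ↦ ⟨1, w, by simpa using h, hw, h0⟩⟩
  rintro ⟨s, w', h', hw', h0'⟩
  have hs : ‖s‖ = 1 := by
    have := congrArg norm (h.symm.trans h')
    rw [norm_mul, norm_pow, norm_eq_one_of_toZMod_ne_zero h0, norm_eq_one_of_toZMod_ne_zero h0',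
      mul_one] at this
    exact (pow_eq_one_iff_of_nonneg (norm_nonneg s) two_ne_zero).mp this.symm
  obtain ⟨s, rfl⟩ : ∃ t : ℤ_[p], (t : ℚ_[p]) = s := ⟨⟨s, hs.le⟩, rfl⟩
  have : w = s ^ 2 * w' := by
    apply Subtype.coe_injective
    simpa using h.symm.trans h'
  rw [this, map_mul, map_pow]
  exact (IsSquare.sq _).mul hw'

end Specialization

/-! ### The curve over ℚ(m, n): -k is not a cube, and the three triples share k. -/

section Generic

instance : Fact (Nat.Prime 19) := ⟨by norm_num⟩

theorem cube_ne_neg_kgen (x : QMN) : x ^ 3 ≠ -kgen := by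
  intro hx
  -- Since 19 ≡ 1 modulo 3, not every residue is a cube; at (4, 10) the residue of -k is a nonzero
  -- noncube.
  obtain ⟨f, c, -, hc, hc', -⟩ := exists_padic_specialization (4 : ZMod 19) 10
  have h1 : 4 * f x ^ 3 = -(c : ℚ_[19]) := by
    rw [← map_pow, hx, map_neg, ← hc]; ring
  have hc0 : PadicInt.toZMod c ≠ 0 := by rw [hc']; decide
  have h4 : ‖(4 : ℚ_[19])‖ = 1 :=
    norm_eq_one_of_toZMod_ne_zero (x := (4 : ℤ_[19])) (by rw [map_ofNat]; decide)
  have hfx : ‖f x‖ = 1 := by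
    have := congrArg norm h1
    rw [norm_mul, norm_pow, norm_neg, h4, norm_eq_one_of_toZMod_ne_zero hc0, one_mul] at this
    exact (pow_eq_one_iff_of_nonneg (norm_nonneg _) three_ne_zero).mp this
  obtain ⟨y, hy⟩ : ∃ y : ℤ_[19], (y : ℚ_[19]) = f x := ⟨⟨f x, hfx.le⟩, rfl⟩
  have h2 : 4 * y ^ 3 = -c := by
    apply Subtype.coe_injective
    rw [← hy] at h1
    exact_mod_cast h1
  have h3 := congrArg PadicInt.toZMod h2
  rw [map_mul, map_pow, map_ofNat, map_neg, hc'] at h3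
  exact (by decide : ∀ r : ZMod 19, ¬ 4 * r ^ 3 = -fourK 4 10) _ h3

theorem kgen_ne_zero : kgen ≠ 0 := fun h ↦ cube_ne_neg_kgen 0 (by rw [h]; simp)

instance : (mordell kgen).IsElliptic := by
  refine ⟨isUnit_iff_ne_zero.mpr ?_⟩
  have : (mordell kgen).Δ = -432 * kgen ^ 2 := by
    simp only [mordell, WeierstrassCurve.Δ, WeierstrassCurve.b₂, WeierstrassCurve.b₄,
      WeierstrassCurve.b₆, WeierstrassCurve.b₈]
    ring
  rw [this]
  exact mul_ne_zero (by norm_num) (pow_ne_zero 2 kgen_ne_zero)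

theorem xs_mul_ys {R : Type*} [CommRing R] (m n : R) (i : Fin 3) :
    xs m n i * ys m n i = xs m n 0 * ys m n 0 := by
  fin_cases i
  exacts [rfl, x2_mul_y2 m n, x3_mul_y3 m n]

theorem cubes_eq (i : Fin 3) :
    xs mvar nvar i ^ 3 + ys mvar nvar i ^ 3 - zs mvar nvar i ^ 3 =
      xs mvar nvar 0 ^ 3 + ys mvar nvar 0 ^ 3 - zs mvar nvar 0 ^ 3 := by
  have hne : tt mvar nvar ^ 3 + mvar * tt mvar nvar - 2 * nvar * tt mvar nvar + 1 ≠ 0 := by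
    intro h
    -- At residues (0, 0) the expression reduces to 1.
    obtain ⟨f, u, v, hu, hv, hu', hv'⟩ := exists_ringHom_padic (0 : ZMod 19) 0
    have h1 := congrArg f h
    simp only [tt, map_add, map_sub, map_mul, map_pow, hu, hv, map_one, map_zero, map_ofNat] at h1
    have h2 : (u ^ 2 - u * v + v ^ 2) ^ 3 + u * (u ^ 2 - u * v + v ^ 2)
        - 2 * v * (u ^ 2 - u * v + v ^ 2) + 1 = 0 := by
      apply Subtype.coe_injective
      exact_mod_cast h1
    simpa [hu', hv'] using congrArg PadicInt.toZMod h2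
  fin_cases i
  · rfl
  · change x2 mvar nvar ^ 3 + y2 mvar nvar ^ 3 - z2 mvar nvar ^ 3 =
      x1 mvar nvar ^ 3 + y1 mvar nvar ^ 3 - z1 mvar nvar ^ 3
    linear_combination z1_cube_sub_z2_cube mvar nvar
  · change x3 mvar nvar ^ 3 + y3 mvar nvar ^ 3 - z3 mvar nvar ^ 3 =
      x1 mvar nvar ^ 3 + y1 mvar nvar ^ 3 - z1 mvar nvar ^ 3
    linear_combination z1_cube_sub_z3_cube hne

theorem phi_eq_four_mul_kgen (i : Fin 3) :
    phi (xs mvar nvar i) (ys mvar nvar i) (zs mvar nvar i) = 4 * kgen := by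
  rw [four_mul_kgen, fourK, phi_eq_sq_sub, phi_eq_sq_sub, cubes_eq, xs_mul_ys]

end Generic

/-! ### The nine points, their coincidences and their independence. -/

section Points

theorem nonsingular_products (i j : Fin 3) : (mordell kgen).Nonsingular
    (abscissa (xs mvar nvar i) (ys mvar nvar i) (zs mvar nvar i) j)
    (ordinate (xs mvar nvar i) (ys mvar nvar i) (zs mvar nvar i) j) := by
  rw [← WeierstrassCurve.Affine.equation_iff_nonsingular, WeierstrassCurve.Affine.equation_iff]
  have h := phi_eq_four_mul_kgen i
  simp only [phi] at h
  fin_cases j <;> simp [mordell, abscissa, ordinate] <;> linear_combination h / 4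

/-- The nine points of the chain. -/
noncomputable def chainPoint (i j : Fin 3) : (mordell kgen).Point :=
  .some _ _ (nonsingular_products i j)

theorem products_eq_of_chainPoint_eq {i j i' j' : Fin 3}
    (h : chainPoint i j = chainPoint i' j') :
    products mvar nvar i j = products mvar nvar i' j' :=
  (WeierstrassCurve.Affine.Point.some.inj h).1

theorem chainPoint_zero_eq (i : Fin 3) : chainPoint i 0 = chainPoint 0 0 := by
  have hx : abscissa (xs mvar nvar i) (ys mvar nvar i) (zs mvar nvar i) 0 =
      abscissa (xs mvar nvar 0) (ys mvar nvar 0) (zs mvar nvar 0) 0 := xs_mul_ys mvar nvar i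
  have hy : ordinate (xs mvar nvar i) (ys mvar nvar i) (zs mvar nvar i) 0 =
      ordinate (xs mvar nvar 0) (ys mvar nvar 0) (zs mvar nvar 0) 0 :=
    congrArg (· / 2) (cubes_eq i)
  simp only [chainPoint, hx, hy]

/-- Indices of the distinct points of the chain. -/
def distinctIndices : Finset (Fin 3 × Fin 3) :=
  {(0, 0), (0, 1), (0, 2), (1, 1), (1, 2), (2, 1), (2, 2)}

theorem chainPoint_injOn :
    Set.InjOn (fun ij : Fin 3 × Fin 3 ↦ chainPoint ij.1 ij.2) distinctIndices := by
  intro p hp q hq h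
  -- The residues (4, 10) already separate the seven abscissas modulo 19.
  obtain ⟨f, -, w, -, -, hw⟩ := exists_padic_specialization (4 : ZMod 19) 10
  have h1 := congrArg f (products_eq_of_chainPoint_eq h)
  rw [(hw _ _).1, (hw _ _).1] at h1
  have h2 := congrArg PadicInt.toZMod (Subtype.coe_injective h1)
  rw [(hw _ _).2, (hw _ _).2] at h2
  have key : ∀ p ∈ distinctIndices, ∀ q ∈ distinctIndices,
    products (4 : ZMod 19) 10 p.1 p.2 = products 4 10 q.1 q.2 → p = q := by decide
  exact key p hp q hq h2

theorem ncard_range_chainPoint :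
    (Set.range fun ij : Fin 3 × Fin 3 ↦ chainPoint ij.1 ij.2).ncard = 7 := by
  have : (Set.range fun ij : Fin 3 × Fin 3 ↦ chainPoint ij.1 ij.2) =
      (fun ij : Fin 3 × Fin 3 ↦ chainPoint ij.1 ij.2) '' distinctIndices := by
    refine subset_antisymm ?_ (Set.image_subset_range _ _)
    rintro _ ⟨⟨i, j⟩, rfl⟩
    by_cases hj : j = 0
    · subst hj
      exact ⟨(0, 0), by decide, (chainPoint_zero_eq i).symm⟩
    · exact ⟨(i, j), by revert hj; revert i j; decide, rfl⟩
  rw [this, chainPoint_injOn.ncard_image, Set.ncard_coe_finset]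
  rfl

/-- Indices of the independent points of the chain. -/
def basisIndex : Fin 6 → Fin 3 × Fin 3 :=
  ![(0, 0), (0, 1), (0, 2), (1, 1), (1, 2), (2, 1)]

/-- Residues of `m` at which `x - θ` is a nonsquare modulo `19` at exactly one of the points. -/
def residueM : Fin 6 → ZMod 19 := ![0, 2, 17, 1, 3, 5]

/-- The residues of `n` matching `residueM`. -/
def residueN : Fin 6 → ZMod 19 := ![5, 13, 7, 8, 0, 4]

/-- The residues of `θ` matching `residueM`. -/
def residueTheta : Fin 6 → ZMod 19 := ![9, 17, 1, 7, 11, 17]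

theorem residueTheta_spec (i : Fin 6) :
    4 * residueTheta i ^ 3 + fourK (residueM i) (residueN i) = 0 ∧ 12 * residueTheta i ^ 2 ≠ 0 := by
  revert i; decide

theorem isSquare_residue_iff (i j : Fin 6) :
    (IsSquare (products (residueM i) (residueN i) (basisIndex j).1 (basisIndex j).2
      - residueTheta i) ↔ j ≠ i) ∧
    products (residueM i) (residueN i) (basisIndex j).1 (basisIndex j).2 - residueTheta i ≠ 0 := by
  revert i j; decide

/-- The descent subgroup cut out by the i-th residue data contains every basis point except the
i-th. -/
theorem even_of_sum_chainPoint_eq_zero {c : Fin 6 → ℤ}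
    (hc : ∑ j, c j • chainPoint (basisIndex j).1 (basisIndex j).2 = 0) (i : Fin 6) :
    Even (c i) := by
  obtain ⟨f, k, w, hk, hk', hw⟩ := exists_padic_specialization (residueM i) (residueN i)
  obtain ⟨θ, hθ, hθ'⟩ := exists_root_of_toZMod k (residueTheta i)
    (by rw [hk']; exact (residueTheta_spec i).1) (residueTheta_spec i).2
  have hθk : (θ : ℚ_[19]) ^ 3 = -f kgen := by
    have : 4 * (θ : ℚ_[19]) ^ 3 + k = 0 := by exact_mod_cast congrArg ((↑) : ℤ_[19] → ℚ_[19]) hθ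
    linear_combination (this + hk) / 4
  have hmem (j : Fin 6) : chainPoint (basisIndex j).1 (basisIndex j).2 ∈
      descentSubgroup f θ hθk cube_ne_neg_kgen (residueSquares 19) sq_mem_residueSquares ↔
      j ≠ i := by
    have hres : PadicInt.toZMod (w (basisIndex j).1 (basisIndex j).2 - θ) =
        products (residueM i) (residueN i) (basisIndex j).1 (basisIndex j).2
          - residueTheta i := by
      rw [map_sub, (hw _ _).2, hθ']
    rw [← (isSquare_residue_iff i j).1, ← hres]
    refine mem_residueSquares_iff ?_ (hres ▸ (isSquare_residue_iff i j).2)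
    rw [PadicInt.coe_sub, ← (hw _ _).1]
    rfl
  exact even_of_sum_zsmul_eq_zero (v := fun j ↦ chainPoint (basisIndex j).1 (basisIndex j).2)
    (two_zsmul_mem_descentSubgroup f θ hθk cube_ne_neg_kgen
    sq_mem_residueSquares) (mt (hmem i).mp (by simp)) (fun j hj ↦ (hmem j).mpr hj) hc

theorem linearIndependent_chainPoint : LinearIndependent ℤ
    ![chainPoint 0 0, chainPoint 0 1, chainPoint 0 2, chainPoint 1 1, chainPoint 1 2,
      chainPoint 2 1] := by
  have h : LinearIndependent ℤ fun j ↦ chainPoint (basisIndex j).1 (basisIndex j).2 :=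
    linearIndependent_int_of_even
      (eq_zero_of_two_zsmul_eq_zero two_ne_zero cube_ne_neg_kgen)
      fun c hc i ↦ even_of_sum_chainPoint_eq_zero hc i
  convert! h using 1
  ext j
  fin_cases j <;> rfl

end Points

end MordellChain

theorem mainTheorem2 :
    -- all three triples give the same `k`
    (∀ i : Fin 3,
      MordellChain.phi (MordellChain.xs MordellChain.mvar MordellChain.nvar i)
        (MordellChain.ys MordellChain.mvar MordellChain.nvar i)
        (MordellChain.zs MordellChain.mvar MordellChain.nvar i) = 4 * MordellChain.kgen) ∧
    -- the curve `y² = x³ + k` over `ℚ(m, n)` is nonsingular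
    MordellChain.genericCurve.IsElliptic ∧
    -- it carries the nine explicit points `P i j`
    (∃ P : Fin 3 → Fin 3 → MordellChain.genericCurve.Point,
      (∀ i j : Fin 3, ∃ h : MordellChain.genericCurve.Nonsingular
          (MordellChain.abscissa (MordellChain.xs MordellChain.mvar MordellChain.nvar i)
            (MordellChain.ys MordellChain.mvar MordellChain.nvar i)
            (MordellChain.zs MordellChain.mvar MordellChain.nvar i) j)
          (MordellChain.ordinate (MordellChain.xs MordellChain.mvar MordellChain.nvar i)
            (MordellChain.ys MordellChain.mvar MordellChain.nvar i)
            (MordellChain.zs MordellChain.mvar MordellChain.nvar i) j),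
        P i j = WeierstrassCurve.Affine.Point.some _ _ h) ∧
      -- the points with abscissas `x₁y₁ = x₂y₂ = x₃y₃` coincide, and exactly seven are distinct
      (P 0 0 = P 1 0 ∧ P 1 0 = P 2 0) ∧
      (Set.range fun ij : Fin 3 × Fin 3 => P ij.1 ij.2).ncard = 7 ∧
      -- six of the seven are linearly independent
      LinearIndependent ℤ ![P 0 0, P 0 1, P 0 2, P 1 1, P 1 2, P 2 1]) ∧
    -- the generic rank is at least six
    6 ≤ Module.rank ℤ MordellChain.genericCurve.Point := by
  have hli := MordellChain.linearIndependent_chainPoint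
  refine ⟨MordellChain.phi_eq_four_mul_kgen,
    inferInstanceAs (MordellChain.mordell MordellChain.kgen).IsElliptic,
    ⟨MordellChain.chainPoint, fun i j ↦ ⟨MordellChain.nonsingular_products i j, rfl⟩,
      ⟨(MordellChain.chainPoint_zero_eq 1).symm,
        (MordellChain.chainPoint_zero_eq 1).trans (MordellChain.chainPoint_zero_eq 2).symm⟩,
      MordellChain.ncard_range_chainPoint, hli⟩, ?_⟩
  have hrank := hli.cardinal_le_rank
  rw [Cardinal.mk_fin] at hrank
  exact hrank
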